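/- Let $(\Omega,\mathcal H,\hat{\mathbb E})$ be a sublinear expectation space: $\mathcal H$ is a linear space of real functions on the set $\Omega$ such that $\psi(Y_1,\dots,Y_n)\in\mathcal H$ whenever $Y_1,\dots,Y_n\in\mathcal H$ and $\psi:\mathbb R^n\to\mathbb R$ is Lipschitz, and $\hat{\mathbb E}:\mathcal H\to\mathbb R$ satisfies, for $Y,Z\in\mathcal H$, $\hat{\mathbb E}[Y]\ge\hat{\mathbb E}[Z]$ if $Y\ge Z$; $\hat{\mathbb E}[c]=c$ for $c\in\mathbb R$; $\hat{\mathbb E}[Y+Z]\le\hat{\mathbb E}[Y]+\hat{\mathbb E}[Z]$; and $\hat{\mathbb E}[aY]=a\hat{\mathbb E}[Y]$ for $a\ge 0$. (No continuity from above of $\hat{\mathbb E}$ is assumed.) Let $\{X_i\}_{i\ge1}\subset\mathcal H$ be an independent sequence, that is, for every $n\ge1$ and every bounded Lipschitz $\psi:\mathbb R^{n+1}\to\mathbb R$, $$\hat{\mathbb E}[\psi(X_1,\dots,X_{n+1})]=\hat{\mathbb E}\Big[\hat{\mathbb E}[\psi(x_1,\dots,x_n,X_{n+1})]\big|_{(x_1,\dots,x_n)=(X_1,\dots,X_n)}\Big].$$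 Assume that the $X_i$ have the same mean-uncertainty, i.e. $\hat{\mathbb E}[X_i]=\overline\mu$ and $-\hat{\mathbb E}[-X_i]=\underline\mu$ for all $i\ge1$, and that $$\lim_{\lambda\to\infty}\sup_{i\ge1}\hat{\mathbb E}[(|X_i|-\lambda)^+]=0 .$$ Let $S_n=X_1+\dots+X_n$, and let $\varphi:\mathbb R\to\mathbb R$ be continuous with linear growth, i.e. $|\varphi(x)|\le C(1+|x|)$ for all $x\in\mathbb R$ and some constant $C$. Then, for every $n\ge 1$, $\varphi(S_n/n)$ belongs to the completion of $\mathcal H$, in the sense that for each $\varepsilon>0$ there are $Z,W\in\mathcal H$ with $|\varphi(S_n/n)-Z|\le W$ and $\hat{\mathbb E}[W]\le\varepsilon$; and $$\lim_{n\to\infty}\hat{\mathbb E}\Big[\varphi\Big(\frac{S_n}{n}\Big)\Big]=\max_{\underline\mu\le\mu\le\overline\mu}\varphi(\mu),$$ where, for functions $Y$ in this completion, $\hat{\mathbb E}[Y]:=\inf\{\hat{\mathbb E}[Z]:Z\in\mathcal H,\ Z\ge Y\}$, which coincides with the original $\hat{\mathbb E}[Y]$ if $Y\in\mathcal H$ and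 is the only value at $Y$ that a monotone sub-additive extension of $\hat{\mathbb E}$ can take. -/

import Mathlib

open Filter Topology

/-- A sublinear expectation space `(Ω, H, Ê)`: `H` is a linear space of real functions on `Ω`,
stable under composition with Lipschitz functions of finitely many of its elements, and `Ê` is a
monotone, constant preserving, sub-additive, positively homogeneous functional on `H`.
The functional is written as a total function, but only its values on `H` carry any meaning:
all laws are required on `H` only. -/
structure SublinearExpectationSpace (Ω : Type*) where
  /-- the space of random variables -/
  H : Submodule ℝ (Ω → ℝ)
  lipschitz_comp_mem : ∀ (n : ℕ) (X : Fin n → Ω → ℝ), (∀ i, X i ∈ H) →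
    ∀ φ : (Fin n → ℝ) → ℝ, (∃ K, LipschitzWith K φ) → (fun ω => φ (fun i => X i ω)) ∈ H
  /-- the sublinear expectation -/
  E : (Ω → ℝ) → ℝ
  mono : ∀ X ∈ H, ∀ Y ∈ H, (∀ ω, Y ω ≤ X ω) → E Y ≤ E X
  const : ∀ c : ℝ, E (fun _ => c) = c
  add_le : ∀ X ∈ H, ∀ Y ∈ H, E (fun ω => X ω + Y ω) ≤ E X + E Y
  smul_eq : ∀ X ∈ H, ∀ a : ℝ, 0 ≤ a → E (fun ω => a * X ω) = a * E X

namespace SublinearExpectationSpace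

variable {Ω : Type*} (S : SublinearExpectationSpace Ω)

/-- With indices starting at `0`: `X n` is independent of `(X 0, …, X (n-1))`, i.e.
`Ê[φ(X 0, …, X n)] = Ê[ Ê[φ(x 0, …, x (n-1), X n)] at x = (X 0, …, X (n-1)) ]`
for all bounded Lipschitz `φ`. -/
def IndepOfPast (X : ℕ → Ω → ℝ) (n : ℕ) : Prop :=
  ∀ φ : (Fin (n + 1) → ℝ) → ℝ, (∃ K, LipschitzWith K φ) → (∃ M : ℝ, ∀ x, |φ x| ≤ M) →
    S.E (fun ω => φ (fun i => X i ω)) =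
      S.E (fun ω => S.E (fun ω' => φ (Fin.snoc (fun i : Fin n => X i ω) (X n ω'))))

/-- An independent sequence of random variables: every later variable is independent of the vector
of its predecessors. -/
def IsIndependent (X : ℕ → Ω → ℝ) : Prop :=
  ∀ n, 1 ≤ n → S.IndepOfPast X n

/-- `Y : Ω → ℝ` belongs to the completion of `H` for the seminorm `Ê[|·|]`: it is approximated by
elements `Z` of `H` with an error `|Y - Z|` dominated by elements of `H` of arbitrarily small
expectation. -/
def MemCompletion (Y : Ω → ℝ) : Prop :=
  ∀ ε : ℝ, 0 < ε → ∃ Z ∈ S.H, ∃ W ∈ S.H, (∀ ω, |Y ω - Z ω| ≤ W ω) ∧ S.E W ≤ ε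

/-- The extension of `Ê` beyond `H`, by `Ê[Y] = inf {Ê[Z] : Z ∈ H, Y ≤ Z}`. It agrees with `Ê` on
`H` (`ext_eq_of_mem`), and on the completion of `H` it is the only possible value of a monotone
sub-additive extension of `Ê` (`ext_unique`). -/
noncomputable def ext (Y : Ω → ℝ) : ℝ :=
  sInf {e : ℝ | ∃ Z ∈ S.H, (∀ ω, Y ω ≤ Z ω) ∧ e = S.E Z}

theorem ext_eq_of_mem {Y : Ω → ℝ} (hY : Y ∈ S.H) : S.ext Y = S.E Y := by
  have : IsLeast {e : ℝ | ∃ Z ∈ S.H, (∀ ω, Y ω ≤ Z ω) ∧ e = S.E Z} (S.E Y) := by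
    refine ⟨⟨Y, hY, fun _ => le_rfl, rfl⟩, ?_⟩
    rintro e ⟨Z, hZ, hle, rfl⟩
    exact S.mono Z hZ Y hY hle
  exact this.csInf_eq

/-- Any monotone sub-additive extension `E'` of `Ê` to a larger linear space `H'` is given by `ext`
at the elements of the completion that lie in `H'`. -/
theorem ext_unique {Y : Ω → ℝ} (hY : S.MemCompletion Y) (H' : Submodule ℝ (Ω → ℝ))
    (hH : S.H ≤ H') (hYH : Y ∈ H') (E' : (Ω → ℝ) → ℝ)
    (hmono : ∀ X ∈ H', ∀ Y ∈ H', (∀ ω, Y ω ≤ X ω) → E' Y ≤ E' X)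
    (hadd : ∀ X ∈ H', ∀ Y ∈ H', E' (fun ω => X ω + Y ω) ≤ E' X + E' Y)
    (hE : ∀ X ∈ S.H, E' X = S.E X) : E' Y = S.ext Y := by
  have hlow : ∀ e ∈ {e : ℝ | ∃ Z ∈ S.H, (∀ ω, Y ω ≤ Z ω) ∧ e = S.E Z}, E' Y ≤ e := by
    rintro e ⟨Z, hZ, hle, rfl⟩
    rw [← hE Z hZ]
    exact hmono Z (hH hZ) Y hYH hle
  apply le_antisymm
  · refine le_csInf ?_ hlow
    obtain ⟨Z, hZ, W, hW, hZW, -⟩ := hY 1 one_pos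
    refine ⟨_, Z + W, S.H.add_mem hZ hW, fun ω => ?_, rfl⟩
    have := (abs_le.1 (hZW ω)).2
    simp only [Pi.add_apply]; linarith
  · refine le_of_forall_pos_le_add fun ε hε => ?_
    obtain ⟨Z, hZ, W, hW, hZW, hWε⟩ := hY (ε / 2) (by positivity)
    have h1 : S.ext Y ≤ S.E (Z + W) := by
      refine csInf_le ⟨_, hlow⟩ ⟨Z + W, S.H.add_mem hZ hW, fun ω => ?_, rfl⟩
      have := (abs_le.1 (hZW ω)).2
      simp only [Pi.add_apply]; linarith
    have h2 : S.E (Z + W) ≤ S.E Z + S.E W := S.add_le Z hZ W hW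
    have h3 : E' Z ≤ E' (Y + W) := by
      refine hmono _ (H'.add_mem hYH (hH hW)) Z (hH hZ) fun ω => ?_
      have := (abs_le.1 (hZW ω)).1
      simp only [Pi.add_apply]; linarith
    have h4 : E' (Y + W) ≤ E' Y + E' W := hadd Y hYH W (hH hW)
    rw [hE Z hZ] at h3
    rw [hE W hW] at h4
    linarith

end SublinearExpectationSpace

/-!
The law of large numbers is proved by second moments of truncated sums, without a limiting partial
differential equation and without any compactness of families of measures.

Truncate the variables at a level `c` and centre them at `m i`; write `z` for a centred summand and
`T` for their sum. Independence allows one to average over the last summand with the others frozen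
(`E_comp_truncSum_succ`), so an inequality for a single summand propagates to the sum.
* If `m i` is the upper mean of the truncated variable, the inequality
  `((x + z)⁺)² ≤ (x⁺)² + 2 x⁺ z + z²` has a cross term of nonpositive upper expectation, because
  `x⁺ ≥ 0`. Hence `Ê[(T⁺)²] ≤ 4 c² n` (`E_sq_max_truncSum_le`).
* If `m i` lies between the lower and the upper mean, the cross term in
  `-(x + z)² = -x² - 2 x z - z²` has nonnegative upper expectation, whatever the sign of `x`. Hence
  `Ê[-T²] ≥ -4 c² n` (`le_E_neg_sq_truncSum`).

Dividing by `n²`, and removing the truncation by the uniform smallness of the tails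
`Ê[(|X i| - c)⁺]`, one obtains `Ê[(S_n / n - μup)⁺] → 0`, the same for the negated variables, and
`Ê[-|S_n / n - μ|] → 0` for each `μ` in `[μlow, μup]`. The first two say that the sample means
concentrate on the interval, which gives the upper bound for `Ê[φ(S_n / n)]`; the last gives the
lower bound `φ μ`.

For `φ` continuous of linear growth, `|φ x - φ y| ≤ δ + L |x - y|` for all `x` and all `y` in a
bounded interval (`exists_abs_sub_le_add_mul`), so these estimates in mean are enough. Membership in
the completion follows from the approximation of `φ` by Lipschitz functions with an error
`δ + 8 C (|x| - c)⁺`, in which the constant in front of the tail does not depend on `δ` or `c`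
(`exists_lipschitzWith_abs_sub_le`).
-/

/-! ### Truncation and Lipschitz approximation of real functions -/

/-- The truncation of a real number at the levels `-c` and `c`, for `c ≥ 0`. -/
noncomputable def clamp (c x : ℝ) : ℝ := max (-c) (min x c)

theorem lipschitzWith_clamp (c : ℝ) : LipschitzWith 1 (clamp c) :=
  (LipschitzWith.id.min_const c).const_max (-c)

theorem abs_clamp_le {c : ℝ} (hc : 0 ≤ c) (x : ℝ) : |clamp c x| ≤ c :=
  abs_le.2 ⟨le_max_left _ _, max_le (by linarith) (min_le_right _ _)⟩

theorem clamp_eq_self {c x : ℝ} (hx : |x| ≤ c) : clamp c x = x := by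
  obtain ⟨h1, h2⟩ := abs_le.1 hx
  rw [clamp, min_eq_left h2, max_eq_right h1]

theorem abs_sub_clamp_le {c : ℝ} (hc : 0 ≤ c) (x : ℝ) :
    |x - clamp c x| ≤ max (|x| - c) 0 := by
  rcases le_total |x| c with h | h
  · rw [clamp_eq_self h]; simp
  · refine le_trans ?_ (le_max_left _ _)
    unfold clamp
    rcases le_total 0 x with h0 | h0
    · rw [abs_of_nonneg h0] at h ⊢
      rw [min_eq_right h, max_eq_right (by linarith), abs_of_nonneg (by linarith)]
    · rw [abs_of_nonpos h0] at h ⊢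
      rw [min_eq_left (by linarith), max_eq_left (by linarith), abs_of_nonpos (by linarith)]
      linarith

/-- A locally Lipschitz function of a bounded Lipschitz function is bounded and Lipschitz. -/
theorem LocallyLipschitz.exists_lipschitzWith_comp_of_bounded {α : Type*} [PseudoMetricSpace α]
    {F : ℝ → ℝ} (hF : LocallyLipschitz F) {s : α → ℝ} {K : NNReal} (hs : LipschitzWith K s)
    {R : ℝ} (hR : ∀ x, |s x| ≤ R) :
    (∃ K', LipschitzWith K' (fun x => F (s x))) ∧ ∃ M : ℝ, ∀ x, |F (s x)| ≤ M := by
  have hmem : ∀ x, s x ∈ Set.Icc (-R) R := fun x => abs_le.1 (hR x)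
  constructor
  · obtain ⟨L, hL⟩ := hF.locallyLipschitzOn.exists_lipschitzOnWith_of_compact
      (isCompact_Icc (a := -R) (b := R))
    refine ⟨L * K, ?_⟩
    rw [← lipschitzOnWith_univ] at hs ⊢
    exact hL.comp hs fun x _ => hmem x
  · obtain ⟨M, hM⟩ := (isCompact_Icc (a := -R) (b := R)).exists_bound_of_continuousOn
      hF.continuous.continuousOn
    exact ⟨M, fun x => hM _ (hmem x)⟩

/-- A continuous function of linear growth is uniformly close to a Lipschitz function, up to a
multiple of `(|x| - c)⁺` that does not depend on the quality of the approximation. -/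
theorem exists_lipschitzWith_abs_sub_le {φ : ℝ → ℝ} (hφ : Continuous φ) {C : ℝ}
    (hC : ∀ x, |φ x| ≤ C * (1 + |x|)) {δ : ℝ} (hδ : 0 < δ) {c : ℝ} (hc : 1 ≤ c) :
    ∃ g : ℝ → ℝ, (∃ K, LipschitzWith K g) ∧
      ∀ x, |φ x - g x| ≤ δ + 8 * C * max (|x| - c) 0 := by
  have hC0 : 0 ≤ C := by simpa using (abs_nonneg _).trans (hC 0)
  obtain ⟨p, hp⟩ := exists_polynomial_near_of_continuousOn (-(2 * c)) (2 * c) φ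
    hφ.continuousOn δ hδ
  have hb := fun x => abs_clamp_le (c := 2 * c) (by linarith) x
  have hplip : LocallyLipschitz (fun x => p.eval x) :=
    (p.contDiff_aeval (𝕜 := ℝ) 1).locallyLipschitz
  refine ⟨fun x => p.eval (clamp (2 * c) x),
    (hplip.exists_lipschitzWith_comp_of_bounded (lipschitzWith_clamp _) hb).1, fun x => ?_⟩
  have h1 := hp _ (abs_le.1 (hb x))
  rw [abs_sub_comm] at h1
  have h2 : |φ x - φ (clamp (2 * c) x)| ≤ 8 * C * max (|x| - c) 0 := by
    rcases le_total |x| (2 * c) with h | h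
    · rw [clamp_eq_self h, sub_self, abs_zero]; positivity
    · have h3 := hC x
      have h4 := (hC (clamp (2 * c) x)).trans
        (mul_le_mul_of_nonneg_left (add_le_add_right (hb x) 1) hC0)
      have h5 := abs_sub (φ x) (φ (clamp (2 * c) x))
      -- for `|x| ≥ 2c ≥ 2` both `1`, `2c` and `|x|` are at most `2(|x| - c)`
      have h6 : C * (1 + |x|) + C * (1 + 2 * c) ≤ 8 * C * (|x| - c) := by
        nlinarith [mul_nonneg hC0 (sub_nonneg.2 h), mul_nonneg hC0 (sub_nonneg.2 hc)]
      have h7 : 8 * C * (|x| - c) ≤ 8 * C * max (|x| - c) 0 :=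
        mul_le_mul_of_nonneg_left (le_max_left _ _) (by positivity)
      linarith
  have := abs_sub_le (φ x) (φ (clamp (2 * c) x)) (p.eval (clamp (2 * c) x))
  linarith

/-- A continuous function of linear growth is Lipschitz at the points of a bounded interval, up to
an arbitrarily small additive error. -/
theorem exists_abs_sub_le_add_mul {φ : ℝ → ℝ} (hφ : Continuous φ) {C : ℝ}
    (hC : ∀ x, |φ x| ≤ C * (1 + |x|)) {δ : ℝ} (hδ : 0 < δ) (a b : ℝ) :
    ∃ L : ℝ, 0 ≤ L ∧ ∀ y ∈ Set.Icc a b, ∀ x, |φ x - φ y| ≤ δ + L * |x - y| := by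
  have hC0 : 0 ≤ C := by simpa using (abs_nonneg _).trans (hC 0)
  set c := max 1 (max |a| |b|) with hcdef
  obtain ⟨g, ⟨K, hK⟩, hg⟩ := exists_lipschitzWith_abs_sub_le hφ hC (half_pos hδ)
    (le_max_left 1 (max |a| |b|))
  refine ⟨K + 8 * C, by positivity, fun y hy x => ?_⟩
  have hyc : |y| ≤ c := (abs_le_max_abs_abs hy.1 hy.2).trans (le_max_right _ _)
  have h1 := hg x
  have h2 := hg y
  rw [max_eq_right (sub_nonpos.2 hyc), abs_sub_comm] at h2
  have h3 := hK.dist_le_mul x y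
  rw [Real.dist_eq, Real.dist_eq] at h3
  have h4 : max (|x| - c) 0 ≤ |x - y| :=
    max_le (by linarith [abs_sub_abs_le_abs_sub x y]) (abs_nonneg _)
  have h5 := mul_le_mul_of_nonneg_left h4 (by positivity : 0 ≤ 8 * C)
  have h6 := abs_sub_le (φ x) (g x) (φ y)
  have h7 := abs_sub_le (g x) (g y) (φ y)
  linarith

namespace SublinearExpectationSpace

variable {Ω : Type*} (S : SublinearExpectationSpace Ω)

/-! ### Calculus in a sublinear expectation space -/

theorem lipschitz_comp_mem_one {Y : Ω → ℝ} (hY : Y ∈ S.H) {f : ℝ → ℝ} {K : NNReal}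
    (hf : LipschitzWith K f) : (fun ω => f (Y ω)) ∈ S.H :=
  S.lipschitz_comp_mem 1 (fun _ => Y) (fun _ => hY) (fun x => f (x 0))
    ⟨K * 1, hf.comp (LipschitzWith.eval (α := fun _ : Fin 1 => ℝ) 0)⟩

theorem const_mem (c : ℝ) : (fun _ => c) ∈ S.H :=
  S.lipschitz_comp_mem 0 (fun _ _ => 0) (fun i => i.elim0) (fun _ => c)
    ⟨0, LipschitzWith.const c⟩

theorem abs_mem {Y : Ω → ℝ} (hY : Y ∈ S.H) : (fun ω => |Y ω|) ∈ S.H :=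
  S.lipschitz_comp_mem_one hY lipschitzWith_one_norm

theorem max_zero_mem {Y : Ω → ℝ} (hY : Y ∈ S.H) : (fun ω => max (Y ω) 0) ∈ S.H :=
  S.lipschitz_comp_mem_one hY (LipschitzWith.id.max_const 0)

theorem add_mem {Y Z : Ω → ℝ} (hY : Y ∈ S.H) (hZ : Z ∈ S.H) : (fun ω => Y ω + Z ω) ∈ S.H :=
  S.H.add_mem hY hZ

theorem sub_mem {Y Z : Ω → ℝ} (hY : Y ∈ S.H) (hZ : Z ∈ S.H) : (fun ω => Y ω - Z ω) ∈ S.H :=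
  S.H.sub_mem hY hZ

theorem neg_mem {Y : Ω → ℝ} (hY : Y ∈ S.H) : (fun ω => -Y ω) ∈ S.H :=
  S.H.neg_mem hY

theorem mul_mem (a : ℝ) {Y : Ω → ℝ} (hY : Y ∈ S.H) : (fun ω => a * Y ω) ∈ S.H :=
  S.H.smul_mem a hY

theorem sum_mem {Y : ℕ → Ω → ℝ} (hY : ∀ i, Y i ∈ S.H) (n : ℕ) :
    (fun ω => ∑ i ∈ Finset.range n, Y i ω) ∈ S.H := by
  convert S.H.sum_mem (t := Finset.range n) (f := Y) fun i _ => hY i using 1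
  ext ω; simp

theorem average_mem {Y : ℕ → Ω → ℝ} (hY : ∀ i, Y i ∈ S.H) (n : ℕ) :
    (fun ω => (∑ i ∈ Finset.range n, Y i ω) / n) ∈ S.H := by
  simp_rw [div_eq_inv_mul]
  exact S.mul_mem _ (S.sum_mem hY n)

theorem E_le_add {X Y Z : Ω → ℝ} (hX : X ∈ S.H) (hY : Y ∈ S.H) (hZ : Z ∈ S.H)
    (h : ∀ ω, X ω ≤ Y ω + Z ω) : S.E X ≤ S.E Y + S.E Z :=
  (S.mono _ (S.add_mem hY hZ) _ hX h).trans (S.add_le Y hY Z hZ)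

theorem E_le_add_const {X Y : Ω → ℝ} (hX : X ∈ S.H) (hY : Y ∈ S.H) {c : ℝ}
    (h : ∀ ω, X ω ≤ Y ω + c) : S.E X ≤ S.E Y + c := by
  simpa [S.const] using S.E_le_add hX hY (S.const_mem c) h

theorem abs_E_sub_le {X Y : Ω → ℝ} (hX : X ∈ S.H) (hY : Y ∈ S.H) {c : ℝ}
    (h : ∀ ω, |X ω - Y ω| ≤ c) : |S.E X - S.E Y| ≤ c := by
  have h1 := S.E_le_add_const hX hY fun ω => by linarith [(abs_le.1 (h ω)).2]
  have h2 := S.E_le_add_const hY hX fun ω => by linarith [(abs_le.1 (h ω)).1]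
  exact abs_le.2 ⟨by linarith, by linarith⟩

/-- The lower expectation `-Ê[-Y]` is at most the upper expectation. -/
theorem neg_E_neg_le {Y : Ω → ℝ} (hY : Y ∈ S.H) : -S.E (fun ω => -Y ω) ≤ S.E Y := by
  have := S.add_le Y hY _ (S.neg_mem hY)
  simp only [add_neg_cancel, S.const] at this
  linarith

theorem E_average_le {Y : ℕ → Ω → ℝ} (hY : ∀ i, Y i ∈ S.H) {b : ℝ} (hb : 0 ≤ b)
    (h : ∀ i, S.E (Y i) ≤ b) (n : ℕ) :
    S.E (fun ω => (∑ i ∈ Finset.range n, Y i ω) / n) ≤ b := by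
  have hsum : S.E (fun ω => ∑ i ∈ Finset.range n, Y i ω) ≤ n * b := by
    induction n with
    | zero => simp [S.const]
    | succ n ih =>
      refine (S.E_le_add (S.sum_mem hY _) (S.sum_mem hY n) (hY n)
        fun ω => (Finset.sum_range_succ _ _).le).trans ?_
      push_cast; linarith [h n]
  simp_rw [div_eq_inv_mul]
  rw [S.smul_eq _ (S.sum_mem hY n) _ (by positivity)]
  refine (mul_le_mul_of_nonneg_left hsum (by positivity)).trans ?_
  rcases eq_or_ne n 0 with rfl | hn
  · simpa using hb
  · have : (n : ℝ) ≠ 0 := by exact_mod_cast hn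
    rw [inv_mul_cancel_left₀ this]

/-- Integrating out the last variable of a Lipschitz function leaves a Lipschitz function. -/
theorem lipschitzWith_E_snoc {n : ℕ} {ψ : (Fin (n + 1) → ℝ) → ℝ} {K : NNReal}
    (hψ : LipschitzWith K ψ) {Y : Ω → ℝ} (hY : Y ∈ S.H) :
    LipschitzWith K (fun x : Fin n → ℝ => S.E (fun ω' => ψ (Fin.snoc x (Y ω')))) := by
  have hdist : ∀ (x y : Fin n → ℝ) (a b : ℝ),
      dist (Fin.snoc x a : Fin (n + 1) → ℝ) (Fin.snoc y b) ≤ max (dist x y) (dist a b) := by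
    intro x y a b
    refine (dist_pi_le_iff (le_max_of_le_left dist_nonneg)).2 fun i => ?_
    refine Fin.lastCases ?_ (fun j => ?_) i
    · simp
    · simpa using Or.inl (dist_le_pi_dist x y j)
  have hmem : ∀ x : Fin n → ℝ, (fun ω' => ψ (Fin.snoc x (Y ω'))) ∈ S.H := fun x => by
    refine S.lipschitz_comp_mem_one hY (f := fun a => ψ (Fin.snoc x a)) (K := K) ?_
    refine LipschitzWith.of_dist_le_mul fun a b => (hψ.dist_le_mul _ _).trans ?_
    exact mul_le_mul_of_nonneg_left (by simpa using hdist x x a b) K.2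
  refine LipschitzWith.of_dist_le_mul fun x y => ?_
  refine S.abs_E_sub_le (hmem x) (hmem y) fun ω => (hψ.dist_le_mul _ _).trans ?_
  exact mul_le_mul_of_nonneg_left (by simpa using hdist x y (Y ω) (Y ω)) K.2

/-! ### Moment bounds for truncated sums -/

/-- The sum of the first `n` variables, truncated at level `c` and centred at `m`. -/
noncomputable def truncSum (c : ℝ) (m : ℕ → ℝ) (X : ℕ → Ω → ℝ) (n : ℕ) (ω : Ω) : ℝ :=
  ∑ i ∈ Finset.range n, (clamp c (X i ω) - m i)

variable {X : ℕ → Ω → ℝ} {c : ℝ} {m : ℕ → ℝ}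

theorem lipschitzWith_sum_clamp_sub (c : ℝ) (m : ℕ → ℝ) (n : ℕ) :
    LipschitzWith n (fun x : Fin n → ℝ => ∑ i, (clamp c (x i) - m i)) := by
  refine LipschitzWith.of_dist_le_mul fun x y => ?_
  rw [Real.dist_eq, ← Finset.sum_sub_distrib]
  refine (Finset.abs_sum_le_sum_abs _ _).trans ?_
  refine (Finset.sum_le_card_nsmul _ _ (dist x y) fun i _ => ?_).trans (by simp)
  have := (lipschitzWith_clamp c).dist_le_mul (x i) (y i)
  rw [Real.dist_eq] at this
  simpa using this.trans (by simpa using dist_le_pi_dist x y i)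

theorem abs_clamp_sub_le (hc : 0 ≤ c) {a : ℝ} (ha : |a| ≤ c) (x : ℝ) :
    |clamp c x - a| ≤ 2 * c := by
  have := abs_sub (clamp c x) a
  linarith [abs_clamp_le hc x]

theorem abs_sum_clamp_sub_le (hc : 0 ≤ c) (hm : ∀ i, |m i| ≤ c) (n : ℕ) (x : Fin n → ℝ) :
    |∑ i, (clamp c (x i) - m i)| ≤ n * (2 * c) := by
  refine (Finset.abs_sum_le_sum_abs _ _).trans ?_
  refine (Finset.sum_le_sum fun (i : Fin n) _ => abs_clamp_sub_le hc (hm i) (x i)).trans ?_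
  simp

theorem comp_truncSum_mem (hX : ∀ i, X i ∈ S.H) (hc : 0 ≤ c) (hm : ∀ i, |m i| ≤ c)
    {F : ℝ → ℝ} (hF : LocallyLipschitz F) (n : ℕ) :
    (fun ω => F (truncSum c m X n ω)) ∈ S.H := by
  convert S.lipschitz_comp_mem n (fun i => X i) (fun i => hX i) _
    (hF.exists_lipschitzWith_comp_of_bounded (lipschitzWith_sum_clamp_sub c m n)
      (abs_sum_clamp_sub_le hc hm n)).1 using 3 with ω
  exact Finset.sum_range _

/-- The expectation of a function of a truncated sum can be computed by first averaging over the
last summand, with the earlier ones frozen. -/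
theorem E_comp_truncSum_succ (hX : ∀ i, X i ∈ S.H) (hind : S.IsIndependent X) (hc : 0 ≤ c)
    (hm : ∀ i, |m i| ≤ c) {F : ℝ → ℝ} (hF : LocallyLipschitz F) (n : ℕ) :
    (fun ω => S.E (fun ω' => F (truncSum c m X n ω + (clamp c (X n ω') - m n)))) ∈ S.H ∧
    S.E (fun ω => F (truncSum c m X (n + 1) ω)) =
      S.E (fun ω => S.E (fun ω' => F (truncSum c m X n ω + (clamp c (X n ω') - m n)))) := by
  obtain ⟨⟨K, hK⟩, hM⟩ := hF.exists_lipschitzWith_comp_of_bounded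
    (lipschitzWith_sum_clamp_sub c m (n + 1)) (abs_sum_clamp_sub_le hc hm (n + 1))
  have hsnoc : ∀ ω ω', F (truncSum c m X n ω + (clamp c (X n ω') - m n)) =
      (fun x : Fin (n + 1) → ℝ => F (∑ i, (clamp c (x i) - m i)))
        (Fin.snoc (fun i : Fin n => X i ω) (X n ω')) := by
    intro ω ω'
    simp only [Fin.sum_univ_castSucc, truncSum, Finset.sum_range, Fin.snoc_castSucc,
      Fin.snoc_last, Fin.val_castSucc, Fin.val_last]
  simp_rw [hsnoc]
  refine ⟨S.lipschitz_comp_mem n (fun i => X i) (fun i => hX i) _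
    ⟨K, S.lipschitzWith_E_snoc hK (hX n)⟩, ?_⟩
  rcases Nat.eq_zero_or_pos n with rfl | hn
  · -- for `n = 0` the outer expectation is that of a constant
    have : ∀ ω : Ω, (fun i : Fin 0 => X i ω) = Fin.elim0 := fun ω => funext fun i => i.elim0
    simp_rw [this, S.const]
    simp [truncSum, Fin.snoc]
  · rw [← hind n hn _ ⟨K, hK⟩ hM]
    simp [truncSum, Finset.sum_range]

/-- If averaging over one more summand raises `F` by at most `a`, then the expectation of `F` of
the sum grows at most linearly. -/
theorem E_comp_truncSum_le (hX : ∀ i, X i ∈ S.H) (hind : S.IsIndependent X) (hc : 0 ≤ c)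
    (hm : ∀ i, |m i| ≤ c) {F : ℝ → ℝ} (hF : LocallyLipschitz F) {a : ℝ}
    (hstep : ∀ n x, S.E (fun ω => F (x + (clamp c (X n ω) - m n))) ≤ F x + a) (n : ℕ) :
    S.E (fun ω => F (truncSum c m X n ω)) ≤ F 0 + n * a := by
  induction n with
  | zero => simp [truncSum, S.const]
  | succ n ih =>
    obtain ⟨hmem, heq⟩ := S.E_comp_truncSum_succ hX hind hc hm hF n
    rw [heq]
    refine (S.E_le_add_const hmem (S.comp_truncSum_mem hX hc hm hF n)
      fun ω => hstep n _).trans ?_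
    push_cast; linarith

theorem le_E_comp_truncSum (hX : ∀ i, X i ∈ S.H) (hind : S.IsIndependent X) (hc : 0 ≤ c)
    (hm : ∀ i, |m i| ≤ c) {F : ℝ → ℝ} (hF : LocallyLipschitz F) {a : ℝ}
    (hstep : ∀ n x, F x - a ≤ S.E (fun ω => F (x + (clamp c (X n ω) - m n)))) (n : ℕ) :
    F 0 - n * a ≤ S.E (fun ω => F (truncSum c m X n ω)) := by
  induction n with
  | zero => simp [truncSum, S.const]
  | succ n ih =>
    obtain ⟨hmem, heq⟩ := S.E_comp_truncSum_succ hX hind hc hm hF n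
    rw [heq]
    have := S.E_le_add_const (c := a) (S.comp_truncSum_mem hX hc hm hF n) hmem
      fun ω => by linarith [hstep n (truncSum c m X n ω)]
    push_cast; linarith

theorem clamp_sub_mem {Y : Ω → ℝ} (hY : Y ∈ S.H) (c a : ℝ) :
    (fun ω => clamp c (Y ω) - a) ∈ S.H :=
  S.sub_mem (S.lipschitz_comp_mem_one hY (lipschitzWith_clamp c)) (S.const_mem a)

theorem comp_add_clamp_sub_mem {Y : Ω → ℝ} (hY : Y ∈ S.H) (hc : 0 ≤ c) {a : ℝ} (ha : |a| ≤ c)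
    {F : ℝ → ℝ} (hF : LocallyLipschitz F) (x : ℝ) :
    (fun ω => F (x + (clamp c (Y ω) - a))) ∈ S.H := by
  have hlip : LipschitzWith 1 (fun y => x + (clamp c y - a)) :=
    LipschitzWith.of_dist_le_mul fun y z => by
      simpa using (lipschitzWith_clamp c).dist_le_mul y z
  obtain ⟨⟨K, hK⟩, -⟩ := hF.exists_lipschitzWith_comp_of_bounded hlip (R := |x| + 2 * c)
    fun y => (abs_add_le _ _).trans (by linarith [abs_clamp_sub_le hc ha y])
  exact S.lipschitz_comp_mem_one hY hK

theorem locallyLipschitz_sq : LocallyLipschitz (fun x : ℝ => x ^ 2) :=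
  (contDiff_id.pow 2 : ContDiff ℝ 1 (fun x : ℝ => x ^ 2)).locallyLipschitz

/-- The upper bound for the positive part: with nonpositive upper means, the second moment of the
positive part of the truncated sum grows at most linearly, since
`((x + z)⁺)² ≤ (x⁺)² + 2 x⁺ z + z²`. -/
theorem E_sq_max_truncSum_le (hX : ∀ i, X i ∈ S.H) (hind : S.IsIndependent X) (hc : 0 ≤ c)
    (hm : ∀ i, |m i| ≤ c) (hmean : ∀ i, S.E (fun ω => clamp c (X i ω) - m i) ≤ 0) (n : ℕ) :
    S.E (fun ω => (max (truncSum c m X n ω) 0) ^ 2) ≤ n * (2 * c) ^ 2 := by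
  have hF : LocallyLipschitz (fun x : ℝ => (max x 0) ^ 2) :=
    locallyLipschitz_sq.comp (LocallyLipschitz.id.max_const 0)
  have := S.E_comp_truncSum_le hX hind hc hm hF (a := (2 * c) ^ 2) (fun n x => ?_) n
  · simpa using this
  have hz := S.clamp_sub_mem (hX n) c (m n)
  have hx : (0 : ℝ) ≤ 2 * max x 0 := by positivity
  refine (S.E_le_add_const (S.comp_add_clamp_sub_mem (hX n) hc (hm n) hF x)
    (S.mul_mem (2 * max x 0) hz) (c := (max x 0) ^ 2 + (2 * c) ^ 2) fun ω => ?_).trans ?_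
  · have hb := sq_le_sq' (abs_le.1 (abs_clamp_sub_le hc (hm n) (X n ω))).1
      (abs_le.1 (abs_clamp_sub_le hc (hm n) (X n ω))).2
    generalize clamp c (X n ω) - m n = z at hb
    rcases le_total (x + z) 0 with h | h
    · rw [max_eq_right h]
      nlinarith [sq_nonneg (max x 0 + z)]
    · rw [max_eq_left h]
      nlinarith [le_max_left x 0]
  · rw [S.smul_eq _ hz _ hx]
    nlinarith [hmean n]

/-- The centres may be chosen between the lower and the upper means; then the upper expectation of
`-T²` decreases at most linearly: at a partial sum `x`, the cross term `-2 x z` has nonnegative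
upper expectation, by the lower mean of `z` if `x ≥ 0` and by the upper mean if `x ≤ 0`. -/
theorem le_E_neg_sq_truncSum (hX : ∀ i, X i ∈ S.H) (hind : S.IsIndependent X) (hc : 0 ≤ c)
    (hm : ∀ i, |m i| ≤ c) (hmean : ∀ i, 0 ≤ S.E (fun ω => clamp c (X i ω) - m i))
    (hmean' : ∀ i, 0 ≤ S.E (fun ω => -(clamp c (X i ω) - m i))) (n : ℕ) :
    -(n * (2 * c) ^ 2) ≤ S.E (fun ω => -(truncSum c m X n ω) ^ 2) := by
  have hF : LocallyLipschitz (fun x : ℝ => -x ^ 2) :=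
    ((contDiff_id.pow 2).neg : ContDiff ℝ 1 (fun x : ℝ => -x ^ 2)).locallyLipschitz
  have := S.le_E_comp_truncSum hX hind hc hm hF (a := (2 * c) ^ 2) (fun n x => ?_) n
  · simpa using this
  have hz := S.clamp_sub_mem (hX n) c (m n)
  have hpos : 0 ≤ S.E (fun ω => (-2 * x) * (clamp c (X n ω) - m n)) := by
    rcases le_total x 0 with h | h
    · rw [S.smul_eq _ hz _ (by linarith)]
      exact mul_nonneg (by linarith) (hmean n)
    · have := S.smul_eq _ (S.neg_mem hz) (2 * x) (by linarith)
      simp only [mul_neg, neg_mul] at this ⊢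
      rw [this]
      exact mul_nonneg (by linarith) (hmean' n)
  have := S.E_le_add_const (c := x ^ 2 + (2 * c) ^ 2) (S.mul_mem (-2 * x) hz)
    (S.comp_add_clamp_sub_mem (hX n) hc (hm n) hF x) fun ω => ?_
  · linarith
  · have hb := sq_le_sq' (abs_le.1 (abs_clamp_sub_le hc (hm n) (X n ω))).1
      (abs_le.1 (abs_clamp_sub_le hc (hm n) (X n ω))).2
    generalize clamp c (X n ω) - m n = z at hb
    nlinarith

/-! ### Concentration of the sample means -/

/-- The truncated expectations `Ê[(|X i| - c)⁺]` vanish uniformly in `i` as `c → ∞`. -/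
def UniformlySmallTails (X : ℕ → Ω → ℝ) : Prop :=
  ∀ ε : ℝ, 0 < ε → ∃ c₀ : ℝ, ∀ c, c₀ ≤ c → ∀ i, S.E (fun ω => max (|X i ω| - c) 0) ≤ ε

theorem tail_mem {Y : Ω → ℝ} (hY : Y ∈ S.H) (c : ℝ) :
    (fun ω => max (|Y ω| - c) 0) ∈ S.H :=
  S.max_zero_mem (S.sub_mem (S.abs_mem hY) (S.const_mem c))

theorem clamp_comp_mem {Y : Ω → ℝ} (hY : Y ∈ S.H) (c : ℝ) :
    (fun ω => clamp c (Y ω)) ∈ S.H :=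
  S.lipschitz_comp_mem_one hY (lipschitzWith_clamp c)

theorem E_clamp_le {Y : Ω → ℝ} (hY : Y ∈ S.H) (hc : 0 ≤ c) :
    S.E (fun ω => clamp c (Y ω)) ≤ S.E Y + S.E (fun ω => max (|Y ω| - c) 0) :=
  S.E_le_add (S.clamp_comp_mem hY c) hY (S.tail_mem hY c) fun ω => by
    linarith [(abs_le.1 (abs_sub_clamp_le hc (Y ω))).1]

theorem le_E_clamp {Y : Ω → ℝ} (hY : Y ∈ S.H) (hc : 0 ≤ c) :
    S.E Y - S.E (fun ω => max (|Y ω| - c) 0) ≤ S.E (fun ω => clamp c (Y ω)) := by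
  have := S.E_le_add hY (S.clamp_comp_mem hY c) (S.tail_mem hY c) fun ω => by
    linarith [(abs_le.1 (abs_sub_clamp_le hc (Y ω))).2]
  linarith

theorem le_E_neg_clamp {Y : Ω → ℝ} (hY : Y ∈ S.H) (hc : 0 ≤ c) :
    S.E (fun ω => -Y ω) - S.E (fun ω => max (|Y ω| - c) 0) ≤ S.E (fun ω => -clamp c (Y ω)) := by
  have := S.E_le_add (S.neg_mem hY) (S.neg_mem (S.clamp_comp_mem hY c)) (S.tail_mem hY c)
    fun ω => by linarith [(abs_le.1 (abs_sub_clamp_le hc (Y ω))).1]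
  linarith

theorem abs_E_clamp_le {Y : Ω → ℝ} (hY : Y ∈ S.H) (hc : 0 ≤ c) :
    |S.E (fun ω => clamp c (Y ω))| ≤ c := by
  have := S.abs_E_sub_le (S.clamp_comp_mem hY c) (S.const_mem 0) (c := c)
    fun ω => by simpa using abs_clamp_le hc (Y ω)
  simpa [S.const] using this

theorem E_sub_const {Y : Ω → ℝ} (hY : Y ∈ S.H) (a : ℝ) : S.E (fun ω => Y ω - a) = S.E Y - a := by
  have h := S.sub_mem hY (S.const_mem a)
  have h1 := S.E_le_add_const h hY (c := -a) fun ω => by linarith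
  have h2 := S.E_le_add_const hY h (c := a) fun ω => by linarith
  linarith

/-- The sample mean differs from that of the truncated variables by the average of the tails, up to
the deviation of the average of the centres. -/
theorem abs_average_sub_le (hc : 0 ≤ c) {a ε : ℝ} (hm : ∀ i, |m i - a| ≤ ε) {n : ℕ} (hn : 0 < n)
    (ω : Ω) :
    |(∑ i ∈ Finset.range n, X i ω) / n - a - truncSum c m X n ω / n| ≤
      (∑ i ∈ Finset.range n, max (|X i ω| - c) 0) / n + ε := by
  have hn' : (0 : ℝ) < n := by exact_mod_cast hn
  have h : (∑ i ∈ Finset.range n, X i ω) / n - a - truncSum c m X n ω / n =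
      (∑ i ∈ Finset.range n, ((X i ω - clamp c (X i ω)) + (m i - a))) / n := by
    simp only [truncSum, Finset.sum_add_distrib, Finset.sum_sub_distrib, Finset.sum_const,
      Finset.card_range, nsmul_eq_mul]
    field_simp
    ring
  have h2 : (∑ i ∈ Finset.range n, max (|X i ω| - c) 0) / n + ε =
      (∑ i ∈ Finset.range n, (max (|X i ω| - c) 0 + ε)) / n := by
    simp only [Finset.sum_add_distrib, Finset.sum_const, Finset.card_range, nsmul_eq_mul]
    field_simp
  rw [h, h2, abs_div, abs_of_pos hn']
  refine div_le_div_of_nonneg_right ?_ hn'.le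
  refine (Finset.abs_sum_le_sum_abs _ _).trans (Finset.sum_le_sum fun i _ => ?_)
  exact (abs_add_le _ _).trans (add_le_add (abs_sub_clamp_le hc _) (hm i))

theorem le_add_inv_mul_sq {ε : ℝ} (hε : 0 < ε) (t : ℝ) : t ≤ ε + ε⁻¹ * t ^ 2 := by
  have h : ε * t ≤ ε * (ε + ε⁻¹ * t ^ 2) := by
    rw [mul_add, mul_inv_cancel_left₀ hε.ne']
    nlinarith [sq_nonneg (t - ε)]
  exact le_of_mul_le_mul_left h hε

theorem eventually_inv_mul_sq_le (c : ℝ) {ε : ℝ} (hε : 0 < ε) :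
    ∀ᶠ n : ℕ in atTop, (ε⁻¹ * ((n : ℝ) ^ 2)⁻¹) * (n * (2 * c) ^ 2) ≤ ε := by
  have h := tendsto_const_div_atTop_nhds_zero_nat (ε⁻¹ * (2 * c) ^ 2)
  filter_upwards [h.eventually_le_const hε, eventually_gt_atTop 0] with n hn hpos
  have hn' : (n : ℝ) ≠ 0 := by exact_mod_cast hpos.ne'
  refine le_trans (le_of_eq ?_) hn
  field_simp

/-- The sample means do not exceed the upper mean by much: `Ê[(S_n / n - μ)⁺] → 0`. -/
theorem eventually_E_max_average_sub_le (hX : ∀ i, X i ∈ S.H) (hind : S.IsIndependent X)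
    (htail : S.UniformlySmallTails X) {μ : ℝ} (hμ : ∀ i, S.E (X i) = μ) {ε : ℝ} (hε : 0 < ε) :
    ∀ᶠ n : ℕ in atTop,
      S.E (fun ω => max ((∑ i ∈ Finset.range n, X i ω) / n - μ) 0) ≤ ε := by
  obtain ⟨δ, hδ, rfl⟩ : ∃ δ : ℝ, 0 < δ ∧ 4 * δ = ε := ⟨ε / 4, by linarith, by ring⟩
  -- the truncation level `c` is fixed first, and `n` is taken large in terms of `c` and `δ`
  obtain ⟨c₀, hc₀⟩ := htail δ hδ
  have hc : 0 ≤ max c₀ 0 := le_max_right _ _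
  have ht := hc₀ _ (le_max_left c₀ 0)
  generalize max c₀ 0 = c at hc ht
  set m : ℕ → ℝ := fun i => S.E (fun ω => clamp c (X i ω)) with hm
  have hmc : ∀ i, |m i| ≤ c := fun i => S.abs_E_clamp_le (hX i) hc
  have hmμ : ∀ i, |m i - μ| ≤ δ := fun i => by
    have h1 := S.E_clamp_le (hX i) hc
    have h2 := S.le_E_clamp (hX i) hc
    rw [hμ i] at h1 h2
    exact abs_le.2 ⟨by linarith [ht i], by linarith [ht i]⟩
  have hsq := S.E_sq_max_truncSum_le hX hind hc hmc fun i =>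
    (by rw [S.E_sub_const (S.clamp_comp_mem (hX i) c)]; exact (sub_self _).le)
  have hF : LocallyLipschitz (fun x : ℝ => (max x 0) ^ 2) :=
    locallyLipschitz_sq.comp (LocallyLipschitz.id.max_const 0)
  filter_upwards [eventually_inv_mul_sq_le c hδ, eventually_gt_atTop 0] with n hn hpos
  have hmem := S.comp_truncSum_mem hX hc hmc hF n
  have hk : (0 : ℝ) ≤ δ⁻¹ * ((n : ℝ) ^ 2)⁻¹ := by positivity
  have havg := S.average_mem (fun i => S.tail_mem (hX i) c) n
  have h1 := S.E_le_add_const (c := 2 * δ)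
    (S.max_zero_mem (S.sub_mem (S.average_mem hX n) (S.const_mem μ)))
    (S.add_mem (S.mul_mem (δ⁻¹ * ((n : ℝ) ^ 2)⁻¹) hmem) havg) fun ω => by
      have h2 := (abs_le.1 (abs_average_sub_le (X := X) hc hmμ hpos ω)).2
      have h3 := le_add_inv_mul_sq hδ (max (truncSum c m X n ω) 0 / n)
      have h4 : truncSum c m X n ω / n ≤ max (truncSum c m X n ω) 0 / n :=
        div_le_div_of_nonneg_right (le_max_left _ _) (by positivity)
      have h5 : 0 ≤ (∑ i ∈ Finset.range n, max (|X i ω| - c) 0) / n :=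
        div_nonneg (Finset.sum_nonneg fun i _ => le_max_right _ _) (by positivity)
      rw [div_pow, div_eq_inv_mul (_ ^ 2), ← mul_assoc] at h3
      refine max_le (by linarith) (by positivity)
  have h2 := S.add_le _ (S.mul_mem (δ⁻¹ * ((n : ℝ) ^ 2)⁻¹) hmem) _ havg
  rw [S.smul_eq _ hmem _ hk] at h2
  have h3 := mul_le_mul_of_nonneg_left (hsq n) hk
  have h4 := S.E_average_le (fun i => S.tail_mem (hX i) c) hδ.le ht n
  linarith

/-- Every point `μ` between the lower and the upper mean is nearly attained by the sample means
under some scenario: `Ê[-|S_n / n - μ|] → 0`. -/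
theorem eventually_le_E_neg_abs_average_sub (hX : ∀ i, X i ∈ S.H) (hind : S.IsIndependent X)
    (htail : S.UniformlySmallTails X) {μ : ℝ} (hμ : ∀ i, μ ≤ S.E (X i))
    (hμ' : ∀ i, -S.E (fun ω => -X i ω) ≤ μ) {ε : ℝ} (hε : 0 < ε) :
    ∀ᶠ n : ℕ in atTop,
      -ε ≤ S.E (fun ω => -|(∑ i ∈ Finset.range n, X i ω) / n - μ|) := by
  obtain ⟨δ, hδ, rfl⟩ : ∃ δ : ℝ, 0 < δ ∧ 4 * δ = ε := ⟨ε / 4, by linarith, by ring⟩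
  -- the truncation level `c` is fixed first, and `n` is taken large in terms of `c` and `δ`
  obtain ⟨c₀, hc₀⟩ := htail δ hδ
  have hc : 0 ≤ max c₀ 0 := le_max_right _ _
  have ht := hc₀ _ (le_max_left c₀ 0)
  generalize max c₀ 0 = c at hc ht
  -- the point closest to `μ` between the means of the truncated variables
  set u : ℕ → ℝ := fun i => S.E (fun ω => clamp c (X i ω)) with hu
  set l : ℕ → ℝ := fun i => -S.E (fun ω => -clamp c (X i ω)) with hl
  set m : ℕ → ℝ := fun i => max (l i) (min μ (u i)) with hm
  have hlu : ∀ i, l i ≤ u i := fun i => S.neg_E_neg_le (S.clamp_comp_mem (hX i) c)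
  have hml : ∀ i, l i ≤ m i := fun i => le_max_left _ _
  have hmu : ∀ i, m i ≤ u i := fun i => max_le (hlu i) (min_le_right _ _)
  have hlc : ∀ i, -c ≤ l i := fun i => by
    have := S.E_le_add_const (c := c) (S.neg_mem (S.clamp_comp_mem (hX i) c)) (S.const_mem 0)
      fun ω => by linarith [(abs_le.1 (abs_clamp_le hc (X i ω))).1]
    rw [S.const] at this
    simp only [hl]; linarith
  have hmc : ∀ i, |m i| ≤ c := fun i =>
    abs_le.2 ⟨(hlc i).trans (hml i), (hmu i).trans (abs_le.1 (S.abs_E_clamp_le (hX i) hc)).2⟩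
  have hmμ : ∀ i, |m i - μ| ≤ δ := fun i => by
    have h1 : μ - δ ≤ u i := by
      have := S.le_E_clamp (hX i) hc
      simp only [hu]; linarith [hμ i, ht i]
    have h2 : l i ≤ μ + δ := by
      have := S.le_E_neg_clamp (hX i) hc
      simp only [hl]; linarith [hμ' i, ht i]
    refine abs_le.2 ⟨?_, ?_⟩
    · have : μ - δ ≤ m i := le_max_of_le_right (le_min (by linarith) h1)
      linarith
    · have : m i ≤ μ + δ := max_le h2 (min_le_of_left_le (by linarith))
      linarith
  have hsq := S.le_E_neg_sq_truncSum hX hind hc hmc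
    (fun i => by
      rw [S.E_sub_const (S.clamp_comp_mem (hX i) c)]; exact sub_nonneg.2 (hmu i))
    (fun i => by
      have h := S.E_sub_const (S.neg_mem (S.clamp_comp_mem (hX i) c)) (-m i)
      have h2 : ∀ ω, -(clamp c (X i ω) - m i) = -clamp c (X i ω) - -m i := fun ω => by ring
      simp_rw [h2, h]
      have := hml i
      simp only [hl] at this
      linarith)
  have hF : LocallyLipschitz (fun x : ℝ => -x ^ 2) :=
    ((contDiff_id.pow 2).neg : ContDiff ℝ 1 (fun x : ℝ => -x ^ 2)).locallyLipschitz
  filter_upwards [eventually_inv_mul_sq_le c hδ, eventually_gt_atTop 0] with n hn hpos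
  have hmem := S.comp_truncSum_mem hX hc hmc hF n
  have hk : (0 : ℝ) ≤ δ⁻¹ * ((n : ℝ) ^ 2)⁻¹ := by positivity
  have havg := S.average_mem (fun i => S.tail_mem (hX i) c) n
  have habs := S.neg_mem (S.abs_mem (S.sub_mem (S.average_mem hX n) (S.const_mem μ)))
  have h1 := S.E_le_add_const (c := 2 * δ) (S.mul_mem (δ⁻¹ * ((n : ℝ) ^ 2)⁻¹) hmem)
    (S.add_mem habs havg) fun ω => by
      have h2 := abs_average_sub_le (X := X) hc hmμ hpos ω
      have h3 := le_add_inv_mul_sq hδ |truncSum c m X n ω / n|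
      have h4 := abs_sub_abs_le_abs_sub ((∑ i ∈ Finset.range n, X i ω) / n - μ)
        (truncSum c m X n ω / n)
      rw [sq_abs, div_pow, div_eq_inv_mul (_ ^ 2), ← mul_assoc] at h3
      linarith
  have h2 := S.add_le _ habs _ havg
  rw [S.smul_eq _ hmem _ hk] at h1
  have h3 := mul_le_mul_of_nonneg_left (hsq n) hk
  have h4 := S.E_average_le (fun i => S.tail_mem (hX i) c) hδ.le ht n
  linarith

theorem IsIndependent.neg (hind : S.IsIndependent X) : S.IsIndependent fun i ω => -X i ω := by
  intro n hn ψ ⟨K, hK⟩ ⟨M, hM⟩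
  have h := hind n hn (fun x => ψ (-x)) ⟨K * 1, hK.comp LipschitzWith.id.neg⟩ ⟨M, fun x => hM _⟩
  have hsnoc : ∀ (x : Fin n → ℝ) (a : ℝ),
      -(Fin.snoc x a : Fin (n + 1) → ℝ) = Fin.snoc (fun i => -x i) (-a) := fun x a => by
    ext i
    refine Fin.lastCases ?_ (fun j => ?_) i <;> simp
  simp_rw [hsnoc] at h
  exact h

/-! ### The extension of the expectation -/

theorem ext_le {Y Z : Ω → ℝ} (hY : S.MemCompletion Y) (hZ : Z ∈ S.H) (h : ∀ ω, Y ω ≤ Z ω) :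
    S.ext Y ≤ S.E Z := by
  obtain ⟨U, hU, W, hW, hUW, -⟩ := hY 1 one_pos
  refine csInf_le ⟨S.E (fun ω => U ω - W ω), ?_⟩ ⟨Z, hZ, h, rfl⟩
  rintro e ⟨V, hV, hle, rfl⟩
  exact S.mono V hV _ (S.sub_mem hU hW) fun ω => by
    linarith [(abs_le.1 (hUW ω)).1, hle ω]

theorem le_ext {Y Z : Ω → ℝ} (hY : S.MemCompletion Y) (hZ : Z ∈ S.H) (h : ∀ ω, Z ω ≤ Y ω) :
    S.E Z ≤ S.ext Y := by
  obtain ⟨U, hU, W, hW, hUW, -⟩ := hY 1 one_pos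
  refine le_csInf ⟨_, fun ω => U ω + W ω, S.add_mem hU hW, fun ω => ?_, rfl⟩ ?_
  · linarith [(abs_le.1 (hUW ω)).2]
  · rintro e ⟨V, hV, hle, rfl⟩
    exact S.mono V hV Z hZ fun ω => (h ω).trans (hle ω)

theorem max_abs_average_sub_le (hc : 0 ≤ c) (n : ℕ) (ω : Ω) :
    max (|(∑ i ∈ Finset.range n, X i ω) / n| - c) 0 ≤
      (∑ i ∈ Finset.range n, max (|X i ω| - c) 0) / n := by
  refine max_le ?_ (div_nonneg (Finset.sum_nonneg fun i _ => le_max_right _ _) (by positivity))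
  rcases Nat.eq_zero_or_pos n with rfl | hn
  · simpa using hc
  have hn' : (0 : ℝ) < n := by exact_mod_cast hn
  rw [abs_div, abs_of_pos hn', sub_le_iff_le_add, div_le_iff₀ hn', add_mul,
    div_mul_cancel₀ _ hn'.ne']
  have h : ∑ i ∈ Finset.range n, |X i ω| ≤ ∑ i ∈ Finset.range n, (max (|X i ω| - c) 0 + c) :=
    Finset.sum_le_sum fun i _ => by linarith [le_max_left (|X i ω| - c) 0]
  rw [Finset.sum_add_distrib, Finset.sum_const, Finset.card_range, nsmul_eq_mul] at h
  linarith [Finset.abs_sum_le_sum_abs (fun i => X i ω) (Finset.range n)]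

/-- Continuous functions of linear growth of the sample means belong to the completion. -/
theorem memCompletion_comp_average (hX : ∀ i, X i ∈ S.H) (htail : S.UniformlySmallTails X)
    {φ : ℝ → ℝ} (hφ : Continuous φ) {C : ℝ} (hC : ∀ x, |φ x| ≤ C * (1 + |x|)) (n : ℕ) :
    S.MemCompletion (fun ω => φ ((∑ i ∈ Finset.range n, X i ω) / n)) := by
  intro ε hε
  have hC0 : 0 ≤ C := by simpa using (abs_nonneg _).trans (hC 0)
  have hδ : 0 < ε / (2 * (8 * C + 1)) := by positivity
  obtain ⟨c₀, hc₀⟩ := htail _ hδ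
  have hc : 1 ≤ max c₀ 1 := le_max_right _ _
  have ht := hc₀ _ (le_max_left c₀ 1)
  generalize max c₀ 1 = c at hc ht
  obtain ⟨g, ⟨K, hK⟩, hg⟩ := exists_lipschitzWith_abs_sub_le hφ hC (half_pos hε) hc
  have havg := S.average_mem (fun i => S.tail_mem (hX i) c) n
  refine ⟨_, S.lipschitz_comp_mem_one (S.average_mem hX n) hK, _,
    S.add_mem (S.mul_mem (8 * C) havg) (S.const_mem (ε / 2)), fun ω => (hg _).trans ?_, ?_⟩
  · have := mul_le_mul_of_nonneg_left (max_abs_average_sub_le (X := X) (zero_le_one.trans hc) n ω)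
      (by positivity : 0 ≤ 8 * C)
    linarith
  · refine (S.add_le _ (S.mul_mem (8 * C) havg) _ (S.const_mem _)).trans ?_
    rw [S.const, S.smul_eq _ havg _ (by positivity)]
    have h1 := mul_le_mul_of_nonneg_left
      (S.E_average_le (fun i => S.tail_mem (hX i) c) hδ.le ht n) (by positivity : 0 ≤ 8 * C)
    have h2 : 8 * C * (ε / (2 * (8 * C + 1))) ≤ ε / 2 := by
      rw [mul_div_assoc', div_le_div_iff₀ (by positivity) two_pos]
      nlinarith
    linarith

theorem uniformlySmallTails_of_tendsto
    (h : Tendsto (fun c : ℝ => ⨆ i, ((S.E (fun ω => max (|X i ω| - c) 0) : ℝ) : EReal))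
      atTop (𝓝 0)) : S.UniformlySmallTails X := by
  intro ε hε
  obtain ⟨c₀, hc₀⟩ := eventually_atTop.1
    (h.eventually_lt_const (EReal.coe_pos.2 hε : (0 : EReal) < (ε : EReal)))
  refine ⟨c₀, fun c hc i => ?_⟩
  exact_mod_cast (le_iSup (fun i => ((S.E (fun ω => max (|X i ω| - c) 0) : ℝ) : EReal)) i).trans
    (hc₀ c hc).le

/-! ### The law of large numbers -/

/-- If `φ ≤ M` on the interval of means, then `Ê[φ(S_n / n)]` is asymptotically at most `M`. -/
theorem eventually_ext_comp_average_le (hX : ∀ i, X i ∈ S.H) (hind : S.IsIndependent X)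
    (htail : S.UniformlySmallTails X) {a b : ℝ} (hb : ∀ i, S.E (X i) = b)
    (ha : ∀ i, -S.E (fun ω => -X i ω) = a) {φ : ℝ → ℝ} (hφ : Continuous φ) {C : ℝ}
    (hC : ∀ x, |φ x| ≤ C * (1 + |x|)) {M : ℝ} (hM : ∀ y ∈ Set.Icc a b, φ y ≤ M)
    {ε : ℝ} (hε : 0 < ε) :
    ∀ᶠ n : ℕ in atTop,
      S.ext (fun ω => φ ((∑ i ∈ Finset.range n, X i ω) / n)) ≤ M + ε := by
  have hab : a ≤ b := by
    have := S.neg_E_neg_le (hX 0)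
    rwa [ha, hb] at this
  obtain ⟨L, hL0, hL⟩ := exists_abs_sub_le_add_mul hφ hC (half_pos hε) a b
  have hδ : 0 < ε / (2 * (2 * L + 1)) := by positivity
  have htail' : S.UniformlySmallTails fun i ω => -X i ω := by
    simpa only [UniformlySmallTails, abs_neg] using htail
  have hneg := S.eventually_E_max_average_sub_le (fun i => S.neg_mem (hX i))
    (IsIndependent.neg S hind) htail' (μ := -a) (fun i => by linarith [ha i]) hδ
  filter_upwards [S.eventually_E_max_average_sub_le hX hind htail hb hδ, hneg] with n h1 h2
  have hp := S.max_zero_mem (S.sub_mem (S.average_mem hX n) (S.const_mem b))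
  have hq := S.max_zero_mem (S.sub_mem (S.average_mem (fun i => S.neg_mem (hX i)) n)
    (S.const_mem (-a)))
  have hpq := S.add_mem hp hq
  have hmul := S.mul_mem L hpq
  refine (S.ext_le (S.memCompletion_comp_average hX htail hφ hC n)
    (S.add_mem hmul (S.const_mem (M + ε / 2))) fun ω => ?_).trans ?_
  · simp only [Finset.sum_neg_distrib, neg_div]
    generalize (∑ i ∈ Finset.range n, X i ω) / (n : ℝ) = x
    -- compare `x` with its projection to the interval
    have hy : max a (min x b) ∈ Set.Icc a b := ⟨le_max_left _ _, max_le hab (min_le_right _ _)⟩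
    have h3 := (abs_le.1 (hL _ hy x)).2
    have h4 : |x - max a (min x b)| ≤ max (x - b) 0 + max (-x - -a) 0 := by
      rcases le_total x a with hxa | hxa
      · rw [min_eq_left (hxa.trans hab), max_eq_left hxa, abs_of_nonpos (by linarith)]
        linarith [le_max_right (x - b) 0, le_max_left (-x - -a) 0]
      rcases le_total x b with hxb | hxb
      · rw [min_eq_left hxb, max_eq_right hxa, sub_self, abs_zero]; positivity
      · rw [min_eq_right hxb, max_eq_right hab, abs_of_nonneg (by linarith)]
        linarith [le_max_left (x - b) 0, le_max_right (-x - -a) 0]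
    linarith [hM _ hy, mul_le_mul_of_nonneg_left h4 hL0]
  · refine (S.add_le _ hmul _ (S.const_mem _)).trans ?_
    rw [S.const, S.smul_eq _ hpq _ hL0]
    have h3 := mul_le_mul_of_nonneg_left ((S.add_le _ hp _ hq).trans (add_le_add h1 h2)) hL0
    have h4 : L * (ε / (2 * (2 * L + 1)) + ε / (2 * (2 * L + 1))) ≤ ε / 2 := by
      rw [← add_div, mul_div_assoc', div_le_div_iff₀ (by positivity) two_pos]
      nlinarith
    linarith

/-- `Ê[φ(S_n / n)]` is asymptotically at least `φ μ` for every `μ` in the interval of means. -/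
theorem eventually_le_ext_comp_average (hX : ∀ i, X i ∈ S.H) (hind : S.IsIndependent X)
    (htail : S.UniformlySmallTails X) {μ : ℝ} (hμ : ∀ i, μ ≤ S.E (X i))
    (hμ' : ∀ i, -S.E (fun ω => -X i ω) ≤ μ) {φ : ℝ → ℝ} (hφ : Continuous φ) {C : ℝ}
    (hC : ∀ x, |φ x| ≤ C * (1 + |x|)) {ε : ℝ} (hε : 0 < ε) :
    ∀ᶠ n : ℕ in atTop,
      φ μ - ε ≤ S.ext (fun ω => φ ((∑ i ∈ Finset.range n, X i ω) / n)) := by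
  obtain ⟨L, hL0, hL⟩ := exists_abs_sub_le_add_mul hφ hC (half_pos hε) μ μ
  have hδ : 0 < ε / (2 * (L + 1)) := by positivity
  filter_upwards [S.eventually_le_E_neg_abs_average_sub hX hind htail hμ hμ' hδ] with n hn
  have habs := S.neg_mem (S.abs_mem (S.sub_mem (S.average_mem hX n) (S.const_mem μ)))
  have hmul := S.mul_mem L habs
  refine le_trans ?_ (S.le_ext (S.memCompletion_comp_average hX htail hφ hC n)
    (S.sub_mem hmul (S.const_mem (-(φ μ - ε / 2)))) fun ω => ?_)
  · rw [S.E_sub_const hmul, S.smul_eq _ habs _ hL0]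
    have h3 := mul_le_mul_of_nonneg_left hn hL0
    have h4 : L * (ε / (2 * (L + 1))) ≤ ε / 2 := by
      rw [mul_div_assoc', div_le_div_iff₀ (by positivity) two_pos]
      nlinarith
    linarith
  · have := (abs_le.1 (hL μ ⟨le_rfl, le_rfl⟩ ((∑ i ∈ Finset.range n, X i ω) / n))).1
    linarith

end SublinearExpectationSpace

theorem mainTheorem9 {Ω : Type*} (S : SublinearExpectationSpace Ω) (X : ℕ → Ω → ℝ)
    (hX : ∀ i, X i ∈ S.H)
    (hindep : S.IsIndependent X)
    (μlow μup : ℝ)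
    (hup : ∀ i, S.E (X i) = μup)
    (hlow : ∀ i, -S.E (fun ω => -X i ω) = μlow)
    (hui : Tendsto (fun c : ℝ => ⨆ i, ((S.E (fun ω => max (|X i ω| - c) 0) : ℝ) : EReal))
      atTop (𝓝 0))
    (φ : ℝ → ℝ) (hφ : Continuous φ) (hgrowth : ∃ C : ℝ, ∀ x, |φ x| ≤ C * (1 + |x|)) :
    (∀ n : ℕ, S.MemCompletion (fun ω => φ ((∑ i ∈ Finset.range n, X i ω) / n))) ∧
    ∃ M : ℝ, IsGreatest (φ '' Set.Icc μlow μup) M ∧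
      Tendsto (fun n : ℕ => S.ext (fun ω => φ ((∑ i ∈ Finset.range n, X i ω) / n)))
        atTop (𝓝 M) := by
  obtain ⟨C, hC⟩ := hgrowth
  have htail := S.uniformlySmallTails_of_tendsto hui
  refine ⟨S.memCompletion_comp_average hX htail hφ hC, ?_⟩
  have hab : μlow ≤ μup := by
    have := S.neg_E_neg_le (hX 0)
    rwa [hlow, hup] at this
  obtain ⟨μ, hμ, hmax⟩ := isCompact_Icc.exists_isMaxOn (Set.nonempty_Icc.2 hab) hφ.continuousOn
  refine ⟨φ μ, ⟨Set.mem_image_of_mem _ hμ, Set.forall_mem_image.2 fun y hy => hmax hy⟩, ?_⟩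
  refine Metric.tendsto_nhds.2 fun ε hε => ?_
  filter_upwards [S.eventually_ext_comp_average_le hX hindep htail hup hlow hφ hC
      (fun y hy => hmax hy) (half_pos hε),
    S.eventually_le_ext_comp_average hX hindep htail (fun i => hμ.2.trans_eq (hup i).symm)
      (fun i => (hlow i).trans_le hμ.1) hφ hC (half_pos hε)] with n h1 h2
  rw [Real.dist_eq, abs_lt]
  constructor <;> linarith
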